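/- **Setting.** Fix $\bar p\in(0,1)$ and $\lambda,\mu,B,c>0$. An agent has to solve a problem by a deadline $T$ and divides one unit of effort, at flow cost $c$, between a *doing* arm and a *thinking* arm. The doing arm is good with prior probability $\bar p$; if good, it brings a solution, worth $B$, at rate $\lambda$, and otherwise it never does. The thinking arm brings progress at rate $\mu$; progress with time $\tau$ remaining is worth $V(\tau)$. The first arrival ends the game. Here $V:[0,\infty)\to\mathbb R$ is three times continuously differentiable, $V(0)=0$, $V'>0$, $-V''/V'\ge\bar p\lambda$, and $V(\infty):=\lim_{\tau\to\infty}V(\tau)$ exists with $c/\mu<V(\infty)\le B+c/\mu$. The agent always exerts full effort; thus a policy for the deadline $T\in[0,\infty)$ is a measurable function $a$ with $a_\tau\in[0,1]$ for $\tau\in[0,T]$, where $a_\tau$ is the share of effort put into doing, absent an arrival, when the remaining time is $\tau$. Let $$A_\tau=\int_\tau^T a_s\,ds,\qquad p_\tau=\frac{\bar p e^{-\lambda A_\tau}}{\bar p e^{-\lambda A_\tau}+1-\bar p},\qquad S_\tau=e^{-\mu(T-\tau-A_\tau)}\left(1-\bar p+\bar p e^{-\lambda A_\tau}\right)$$ be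 the past effort on doing, the belief that the doing arm is good, and the probability that nothing has arrived yet. A policy is *optimal* for $T$ if it maximizes $$\int_0^T S_\tau\left(\mu(1-a_\tau)V(\tau)+\lambda a_\tau p_\tau B-c\right)d\tau$$ among all policies for $T$. The probability that the problem is solved through the doing arm under the policy $a$ is $\int_0^T S_\tau\,\lambda a_\tau p_\tau\,d\tau$. Finally let $$\hat p=\frac{c/\lambda}{B-V(\infty)+c/\mu}\quad(\hat p=+\infty\text{ if the denominator is }0),$$ $$q(\tau)=\min\left\{1,\ \frac{\mu\,(V(\tau)+c\tau)}{\mu(B+c\tau)+(\lambda-\mu)\left(B-(1-e^{-\lambda\tau})(B-c/\lambda)\right)}\right\}.$$ **Corollary 1.** 1. Let $a$ be an optimal policy for a deadline $T\ge0$. Throughout the thinking phase, i.e. for almost every $\tau\in[0,T]$ with $a_\tau<1$, the belief satisfies $p_\tau\ge\min\{\hat p,\bar p\}$, and $p_\tau>\hat p$ if $\hat p<\bar p$. 2. Suppose that $\bar p\le\hat p$. Then there is exactly one $T_1\ge 0$ with $q(T_1)=\bar p$, written $T_1=q^{-1}(\bar p)$, and $T_1>0$. For every deadline $T\ge0$ an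 optimal policy exists, and the probability $P(T)$ that the problem is solved through the doing arm is the same under all optimal policies for $T$. The function $P$ attains its maximum over $[0,\infty)$ at $T=T_1$. -/

import Mathlib

open Set Filter Topology MeasureTheory

/-- Primitives of the thinking-versus-doing problem: the prior `pbar` that the doing arm is good,
the arrival rate `lam` of a solution on a good doing arm, the arrival rate `mu` of progress on the
thinking arm, the value `B` of a solution, the flow cost `c` of effort, and the value `V τ` of
progress that arrives with time `τ ≥ 0` remaining. -/
structure ThinkDo where
  pbar : ℝ
  lam : ℝ
  mu : ℝ
  B : ℝ
  c : ℝ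
  V : ℝ → ℝ

noncomputable section

namespace ThinkDo

variable (M : ThinkDo)

/-- A policy for the deadline `T`, in terms of the time remaining `τ ∈ [0, T]`: `a τ` is the share
of the unit of effort that goes to the doing arm with `τ` remaining (absent any arrival), and
`1 - a τ` goes to the thinking arm. -/
def IsPolicy (T : ℝ) (a : ℝ → ℝ) : Prop :=
  Measurable a ∧ ∀ τ ∈ Icc 0 T, a τ ∈ Icc (0 : ℝ) 1

/-- Past effort `A_τ` on the doing arm when `τ` is the time remaining. -/
def pastDoing (T : ℝ) (a : ℝ → ℝ) (τ : ℝ) : ℝ := ∫ s in τ..T, a s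

/-- The Bayesian belief `p_τ` that the doing arm is good, absent any arrival. -/
def belief (T : ℝ) (a : ℝ → ℝ) (τ : ℝ) : ℝ :=
  M.pbar * Real.exp (-M.lam * pastDoing T a τ) /
    (M.pbar * Real.exp (-M.lam * pastDoing T a τ) + (1 - M.pbar))

/-- Probability that no progress has arrived before `τ` is the time remaining. -/
def noProgress (T : ℝ) (a : ℝ → ℝ) (τ : ℝ) : ℝ :=
  Real.exp (-M.mu * (T - τ - pastDoing T a τ))

/-- Probability that effort on the doing arm has brought no solution before `τ` is the time
remaining. -/
def noSolution (T : ℝ) (a : ℝ → ℝ) (τ : ℝ) : ℝ :=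
  1 - M.pbar + M.pbar * Real.exp (-M.lam * pastDoing T a τ)

/-- The agent's expected payoff: the flow payoff, net of the effort cost, weighted by the
probability that the game has not ended yet. -/
def payoff (T : ℝ) (a : ℝ → ℝ) : ℝ :=
  ∫ τ in (0 : ℝ)..T, M.noProgress T a τ * M.noSolution T a τ *
    (M.mu * (1 - a τ) * M.V τ + M.lam * a τ * M.belief T a τ * M.B - M.c)

/-- An optimal policy of the agent for the deadline `T`. -/
def IsOptimal (T : ℝ) (a : ℝ → ℝ) : Prop :=
  IsPolicy T a ∧ ∀ b, IsPolicy T b → M.payoff T b ≤ M.payoff T a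

/-- Probability that the problem is solved through the doing arm by the deadline `T`: the
instantaneous arrival rate of a solution on the doing arm, weighted by the probability that the
game has not ended yet. -/
def doingProb (T : ℝ) (a : ℝ → ℝ) : ℝ :=
  ∫ τ in (0 : ℝ)..T, M.noProgress T a τ * M.noSolution T a τ *
    (M.lam * a τ * M.belief T a τ)

/-- The indifference ratio `q̂`, before truncation at one. -/
def qRatio (τ : ℝ) : ℝ :=
  M.mu * (M.V τ + M.c * τ) /
    (M.mu * (M.B + M.c * τ) +
      (M.lam - M.mu) * (M.B - (1 - Real.exp (-M.lam * τ)) * (M.B - M.c / M.lam)))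

/-- The belief `q τ` with which the agent enters the final doing period with `τ` remaining. -/
def q (τ : ℝ) : ℝ := min 1 (M.qRatio τ)

/-- The threshold belief `p̂` of the problem without a deadline, where `Vinf` is the limit of `V`
at infinity. It is infinite (doing is never worthwhile) if its denominator vanishes. -/
def pHat (Vinf : ℝ) : EReal :=
  if 0 < M.B - Vinf + M.c / M.mu then
    (((M.c / M.lam) / (M.B - Vinf + M.c / M.mu) : ℝ) : EReal)
  else ⊤

end ThinkDo

end

/-! With `A` for past doing effort, the payoff is the integral of a one-form in `(τ, A)` along the
path of `A`. Subtracting an exact part (`IsPolicy.payoff_eq`) leaves a flow depending on `A_τ`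
alone, whose derivative in `A_τ` is a negative multiple of `swapGain`. Where `swapGain` is positive,
less past effort at each date is better. With total effort fixed, the lowest path thinks first and
does last, so an optimal policy must follow it (`IsPolicy.payoff_delay`,
`IsOptimal.ae_pastDoing_le`).

The sign of `swapGain` is that of `beliefGain`, which decreases in the belief and, for beliefs up to
`pbar`, in the remaining time by the curvature condition on `V`. Its bound at an infinite horizon
changes sign at the threshold `pHat`; this gives the claim on beliefs.

If `pbar` is at most `pHat`, each policy is dominated by a single switch with the same total doing
effort `k`. The derivative in `k` has the sign of `switchGain`, which crosses zero once, at the root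
`T₁` of `q = pbar`. Hence the optimum does for the last `min T T₁`. A longer deadline first adds
doing time, then only thinking that may preempt it, so `T₁` maximizes the doing probability. -/

noncomputable section

namespace ThinkDo

variable {M : ThinkDo} {Vinf T k : ℝ} {a : ℝ → ℝ}

/-! ### Past effort as a function of remaining time -/

theorem IsPolicy.intervalIntegrable (ha : IsPolicy T a) {x y : ℝ} (hx : x ∈ Icc 0 T)
    (hy : y ∈ Icc 0 T) : IntervalIntegrable a volume x y := by
  rw [intervalIntegrable_iff]
  refine Measure.integrableOn_of_bounded (M := 1) (by simp) ha.1.aestronglyMeasurable ?_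
  refine (ae_restrict_iff' measurableSet_uIoc).2 (Eventually.of_forall fun τ hτ => ?_)
  have h := ha.2 τ (uIcc_subset_Icc hx hy (uIoc_subset_uIcc hτ))
  rw [Real.norm_eq_abs, abs_le]
  exact ⟨by linarith [h.1], h.2⟩

theorem IsPolicy.pastDoing_sub (ha : IsPolicy T a) {x y : ℝ} (hx : x ∈ Icc 0 T)
    (hy : y ∈ Icc 0 T) : pastDoing T a x - pastDoing T a y = ∫ s in x..y, a s := by
  have hT : T ∈ Icc 0 T := ⟨hx.1.trans hx.2, le_rfl⟩
  unfold pastDoing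
  rw [← intervalIntegral.integral_add_adjacent_intervals (ha.intervalIntegrable hx hy)
    (ha.intervalIntegrable hy hT)]
  ring

theorem pastDoing_self : pastDoing T a T = 0 := by simp [pastDoing]

theorem IsPolicy.pastDoing_sub_nonneg (ha : IsPolicy T a) {x y : ℝ} (hx : x ∈ Icc 0 T)
    (hy : y ∈ Icc 0 T) (hxy : x ≤ y) : 0 ≤ pastDoing T a x - pastDoing T a y := by
  rw [ha.pastDoing_sub hx hy]
  exact intervalIntegral.integral_nonneg hxy fun s hs =>
    (ha.2 s ⟨hx.1.trans hs.1, hs.2.trans hy.2⟩).1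

theorem IsPolicy.pastDoing_sub_le (ha : IsPolicy T a) {x y : ℝ} (hx : x ∈ Icc 0 T)
    (hy : y ∈ Icc 0 T) (hxy : x ≤ y) : pastDoing T a x - pastDoing T a y ≤ y - x := by
  rw [ha.pastDoing_sub hx hy]
  have := intervalIntegral.integral_mono_on hxy (ha.intervalIntegrable hx hy)
    (intervalIntegrable_const (c := (1 : ℝ))) fun s hs =>
    (ha.2 s ⟨hx.1.trans hs.1, hs.2.trans hy.2⟩).2
  simpa using this

/-- Shares lie in `[0, 1]`. This regularity replaces differentiability, since the policy is merely
measurable. -/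
theorem IsPolicy.lipschitzOnWith (ha : IsPolicy T a) :
    LipschitzOnWith 1 (pastDoing T a) (Icc 0 T) := by
  refine LipschitzOnWith.of_dist_le_mul fun x hx y hy => ?_
  rw [Real.dist_eq, Real.dist_eq, NNReal.coe_one, one_mul]
  rcases le_total x y with h | h
  · rw [abs_of_nonneg (ha.pastDoing_sub_nonneg hx hy h), abs_sub_comm,
      abs_of_nonneg (sub_nonneg.2 h)]
    exact ha.pastDoing_sub_le hx hy h
  · rw [abs_sub_comm, abs_of_nonneg (ha.pastDoing_sub_nonneg hy hx h),
      abs_of_nonneg (sub_nonneg.2 h)]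
    exact ha.pastDoing_sub_le hy hx h

theorem IsPolicy.pastDoing_mem (ha : IsPolicy T a) {x : ℝ} (hx : x ∈ Icc 0 T) :
    pastDoing T a x ∈ Icc 0 T := by
  have hT : T ∈ Icc 0 T := ⟨hx.1.trans hx.2, le_rfl⟩
  have h1 := ha.pastDoing_sub_nonneg hx hT hx.2
  have h2 := ha.pastDoing_sub_le hx hT hx.2
  rw [pastDoing_self] at h1 h2
  exact ⟨by linarith, by linarith [hx.1]⟩

theorem IsPolicy.ae_hasDerivAt_pastDoing (ha : IsPolicy T a) (hT : 0 ≤ T) :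
    ∀ᵐ τ, τ ∈ Icc 0 T → HasDerivAt (pastDoing T a) (-a τ) τ := by
  have h := (ha.intervalIntegrable (left_mem_Icc.2 hT)
    (right_mem_Icc.2 hT)).ae_hasDerivAt_integral
  rw [uIcc_of_le hT] at h
  filter_upwards [h] with τ hτ hmem
  have h1 := (hτ hmem T ⟨hT, le_rfl⟩).neg
  refine h1.congr_of_eventuallyEq (Eventually.of_forall fun x => ?_)
  simp only [pastDoing, Pi.neg_apply]
  rw [intervalIntegral.integral_symm]

/-! ### Splitting the payoff into a potential and a reduced flow -/

variable (M) in
/-- Probability that `y` units of doing effort bring no solution. -/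
def unsolved (y : ℝ) : ℝ := 1 - M.pbar + M.pbar * Real.exp (-M.lam * y)

variable (M) in
/-- The rate at which delaying doing in favour of thinking raises the payoff, when `τ` is the time
remaining and `y` the past effort on doing (up to a positive factor). -/
def swapGain (τ y : ℝ) : ℝ :=
  (M.c + derivWithin M.V (Ici 0) τ) * M.unsolved y -
    M.lam * (M.pbar * Real.exp (-M.lam * y)) * (M.B + M.c / M.mu - M.V τ)

variable (M) in
/-- Primitive in the doing effort of the discounted chance of a solution. -/
def solvedPrimitive (y : ℝ) : ℝ := ∫ u in (0 : ℝ)..y, Real.exp ((M.mu - M.lam) * u)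

variable (M) in
/-- Primitive in the doing effort of the discounted survival probability. -/
def survivalPrimitive (y : ℝ) : ℝ := ∫ u in (0 : ℝ)..y, Real.exp (M.mu * u) * M.unsolved u

variable (M) in
/-- The potential whose derivative in the doing effort `y` is the payoff from doing rather than
thinking. -/
def potential (T τ y : ℝ) : ℝ :=
  Real.exp (-M.mu * (T - τ)) *
    (M.B * M.lam * M.pbar * M.solvedPrimitive y - M.mu * M.V τ * M.survivalPrimitive y)

variable (M) in
/-- The flow payoff, as a function of the past effort on doing only, that remains once the
potential is split off. -/
def reducedFlow (T τ y : ℝ) : ℝ :=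
  Real.exp (-M.mu * (T - τ)) *
    (Real.exp (M.mu * y) * M.unsolved y * (M.mu * M.V τ - M.c) +
      M.mu * (M.B * M.lam * M.pbar * M.solvedPrimitive y - M.mu * M.V τ * M.survivalPrimitive y) -
      M.mu * derivWithin M.V (Ici 0) τ * M.survivalPrimitive y)

theorem continuous_unsolved : Continuous M.unsolved := by unfold unsolved; fun_prop

theorem hasDerivAt_unsolved (y : ℝ) :
    HasDerivAt M.unsolved (-M.lam * (M.pbar * Real.exp (-M.lam * y))) y := by
  have h := ((((hasDerivAt_id' y).const_mul (-M.lam)).exp).const_mul M.pbar).const_add (1 - M.pbar)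
  exact h.congr_deriv (by ring)

theorem hasDerivAt_solvedPrimitive (y : ℝ) :
    HasDerivAt M.solvedPrimitive (Real.exp ((M.mu - M.lam) * y)) y :=
  (by fun_prop : Continuous fun u => Real.exp ((M.mu - M.lam) * u)).integral_hasStrictDerivAt
    0 y |>.hasDerivAt

theorem hasDerivAt_survivalPrimitive (y : ℝ) :
    HasDerivAt M.survivalPrimitive (Real.exp (M.mu * y) * M.unsolved y) y :=
  ((by fun_prop : Continuous fun u => Real.exp (M.mu * u)).mul
    continuous_unsolved).integral_hasStrictDerivAt 0 y |>.hasDerivAt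

theorem IsPolicy.absolutelyContinuous_comp (ha : IsPolicy T a) (hT : 0 ≤ T) {f f' : ℝ → ℝ}
    (hf : ∀ y, HasDerivAt f (f' y) y) (hf' : Continuous f') :
    AbsolutelyContinuousOnInterval (fun τ => f (pastDoing T a τ)) 0 T := by
  have hd : deriv f = f' := funext fun y => (hf y).deriv
  have hC : ContDiff ℝ 1 f :=
    contDiff_one_iff_deriv.2 ⟨fun y => (hf y).differentiableAt, hd ▸ hf'⟩
  obtain ⟨K, hK⟩ := hC.contDiffOn.exists_lipschitzOnWith (by decide) (convex_Icc 0 T)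
    isCompact_Icc
  refine LipschitzOnWith.absolutelyContinuousOnInterval (K := K * 1) ?_
  rw [uIcc_of_le hT]
  exact hK.comp ha.lipschitzOnWith fun x hx => ha.pastDoing_mem hx

theorem IsPolicy.absolutelyContinuous_potential (ha : IsPolicy T a) (hT : 0 ≤ T)
    (hV : ContDiffOn ℝ 1 M.V (Ici 0)) :
    AbsolutelyContinuousOnInterval (fun τ => M.potential T τ (pastDoing T a τ)) 0 T := by
  have hsub : uIcc 0 T ⊆ Ici 0 := by rw [uIcc_of_le hT]; exact fun x hx => hx.1
  have h1 := ha.absolutelyContinuous_comp hT (M.hasDerivAt_solvedPrimitive) (by fun_prop)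
  have h2 := ha.absolutelyContinuous_comp hT (M.hasDerivAt_survivalPrimitive)
    ((by fun_prop : Continuous fun u => Real.exp (M.mu * u)).mul continuous_unsolved)
  have h3 : AbsolutelyContinuousOnInterval M.V 0 T :=
    (hV.mono hsub).absolutelyContinuousOnInterval
  have h4 : AbsolutelyContinuousOnInterval (fun τ => Real.exp (-M.mu * (T - τ))) 0 T :=
    (by fun_prop : ContDiff ℝ 1 fun τ : ℝ =>
      Real.exp (-M.mu * (T - τ))).contDiffOn.absolutelyContinuousOnInterval
  exact h4.mul ((h1.const_mul (M.B * M.lam * M.pbar)).sub ((h3.const_mul M.mu).mul h2))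

/-- The normalizing denominator of the belief is the no-solution probability itself, so the flow
payoff is affine in the share with coefficients explicit in past effort. -/
theorem noSolution_mul_belief (hp : M.pbar ∈ Ioo (0 : ℝ) 1) (T : ℝ) (a : ℝ → ℝ) (τ : ℝ) :
    M.noSolution T a τ * M.belief T a τ = M.pbar * Real.exp (-M.lam * pastDoing T a τ) := by
  have h : 0 < M.pbar * Real.exp (-M.lam * pastDoing T a τ) + (1 - M.pbar) := by
    have := mul_pos hp.1 (Real.exp_pos (-M.lam * pastDoing T a τ))
    linarith [hp.2]
  unfold noSolution belief
  rw [mul_div_assoc', div_eq_iff h.ne']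
  ring

theorem hasDerivAt_value (hV : ContDiffOn ℝ 1 M.V (Ici 0)) {τ : ℝ} (hτ : 0 < τ) :
    HasDerivAt M.V (derivWithin M.V (Ici 0) τ) τ :=
  ((hV.differentiableOn one_ne_zero) τ hτ.le).hasDerivWithinAt.hasDerivAt (Ici_mem_nhds hτ)

theorem continuousOn_reducedFlow (ha : IsPolicy T a) (hV : ContDiffOn ℝ 1 M.V (Ici 0)) :
    ContinuousOn (fun τ => M.reducedFlow T τ (pastDoing T a τ)) (Icc 0 T) := by
  have hA := ha.lipschitzOnWith.continuousOn
  have hsub : Icc 0 T ⊆ Ici 0 := fun x hx => hx.1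
  have h3 := hV.continuousOn.mono hsub
  have h4 : ContinuousOn (derivWithin M.V (Ici 0)) (Icc 0 T) :=
    (hV.continuousOn_derivWithin (uniqueDiffOn_Ici 0) le_rfl).mono hsub
  have h1 : ContinuousOn (fun τ => M.solvedPrimitive (pastDoing T a τ)) (Icc 0 T) :=
    (continuous_iff_continuousAt.2 fun y =>
      (M.hasDerivAt_solvedPrimitive y).continuousAt).comp_continuousOn hA
  have h2 : ContinuousOn (fun τ => M.survivalPrimitive (pastDoing T a τ)) (Icc 0 T) :=
    (continuous_iff_continuousAt.2 fun y =>
      (M.hasDerivAt_survivalPrimitive y).continuousAt).comp_continuousOn hA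
  have h5 : ContinuousOn (fun τ => M.unsolved (pastDoing T a τ)) (Icc 0 T) :=
    M.continuous_unsolved.comp_continuousOn hA
  unfold reducedFlow
  fun_prop

/-- The payoff depends on the policy through past effort only, as a potential at the deadline plus
the integral of the reduced flow. -/
theorem IsPolicy.payoff_eq (ha : IsPolicy T a) (hT : 0 ≤ T) (hp : M.pbar ∈ Ioo (0 : ℝ) 1)
    (hV : ContDiffOn ℝ 1 M.V (Ici 0)) :
    M.payoff T a = M.potential T 0 (pastDoing T a 0) +
      ∫ τ in (0 : ℝ)..T, M.reducedFlow T τ (pastDoing T a τ) := by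
  have hac := ha.absolutelyContinuous_potential hT hV
  have hpot : M.potential T T (pastDoing T a T) = 0 := by
    simp [potential, pastDoing_self, solvedPrimitive, survivalPrimitive]
  have hftc := hac.integral_deriv_eq_sub
  simp only [hpot, zero_sub] at hftc
  have hint : IntervalIntegrable (fun τ => M.reducedFlow T τ (pastDoing T a τ)) volume 0 T := by
    refine ContinuousOn.intervalIntegrable ?_
    rw [uIcc_of_le hT]
    exact continuousOn_reducedFlow ha hV
  -- Along the path `dA/dτ = -a` almost everywhere, so subtracting the total derivative of the
  -- potential removes every term containing the share.
  have key : M.payoff T a = ∫ τ in (0 : ℝ)..T, (M.reducedFlow T τ (pastDoing T a τ) -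
      deriv (fun τ => M.potential T τ (pastDoing T a τ)) τ) := by
    unfold payoff
    refine intervalIntegral.integral_congr_ae ?_
    filter_upwards [ha.ae_hasDerivAt_pastDoing hT] with τ hτ hmem
    rw [uIoc_of_le hT] at hmem
    have hA := hτ ⟨hmem.1.le, hmem.2⟩
    have hVd := hasDerivAt_value hV hmem.1
    have h1 := (M.hasDerivAt_solvedPrimitive (pastDoing T a τ)).comp τ hA
    have h2 := (M.hasDerivAt_survivalPrimitive (pastDoing T a τ)).comp τ hA
    have h4 : HasDerivAt (fun τ => Real.exp (-M.mu * (T - τ)))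
        (M.mu * Real.exp (-M.mu * (T - τ))) τ := by
      convert (((hasDerivAt_id' τ).const_sub T).const_mul (-M.mu)).exp using 1
      ring
    have hd := (h4.mul ((h1.const_mul (M.B * M.lam * M.pbar)).sub
      ((hVd.const_mul M.mu).mul h2))).deriv
    have hfun : (fun τ => M.potential T τ (pastDoing T a τ)) =
      (fun τ => Real.exp (-M.mu * (T - τ))) *
        ((fun τ => M.B * M.lam * M.pbar * (M.solvedPrimitive ∘ pastDoing T a) τ) -
          (fun τ => M.mu * M.V τ) * (M.survivalPrimitive ∘ pastDoing T a)) := rfl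
    rw [hfun, hd]
    have e1 : Real.exp ((M.mu - M.lam) * pastDoing T a τ) =
        Real.exp (M.mu * pastDoing T a τ) * Real.exp (-M.lam * pastDoing T a τ) := by
      rw [← Real.exp_add]; ring_nf
    have e2 : M.noProgress T a τ =
        Real.exp (-M.mu * (T - τ)) * Real.exp (M.mu * pastDoing T a τ) := by
      rw [noProgress, ← Real.exp_add]; ring_nf
    have e3 := M.noSolution_mul_belief hp T a τ
    have e4 : M.noSolution T a τ = M.unsolved (pastDoing T a τ) := rfl
    have e5 : M.noProgress T a τ * M.noSolution T a τ *
        (M.mu * (1 - a τ) * M.V τ + M.lam * a τ * M.belief T a τ * M.B - M.c) =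
        M.noProgress T a τ * (M.noSolution T a τ * (M.mu * (1 - a τ) * M.V τ - M.c) +
          M.lam * a τ * (M.noSolution T a τ * M.belief T a τ) * M.B) := by ring
    rw [e5, e3, e4, e2]
    simp only [reducedFlow, Pi.sub_apply, Pi.mul_apply, Function.comp_apply]
    rw [e1]
    ring
  rw [key, intervalIntegral.integral_sub hint hac.intervalIntegrable_deriv, hftc]
  ring

/-- This is the curl of the one-form behind the payoff: the `μ² V` terms cancel, leaving the gain
from exchanging the order of doing and thinking. -/
theorem hasDerivAt_reducedFlow (hmu : 0 < M.mu) (T τ y : ℝ) :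
    HasDerivAt (M.reducedFlow T τ)
      (-(M.mu * Real.exp (-M.mu * (T - τ)) * Real.exp (M.mu * y) * M.swapGain τ y)) y := by
  have h0 : HasDerivAt (fun y => Real.exp (M.mu * y)) (Real.exp (M.mu * y) * (M.mu * 1)) y :=
    ((hasDerivAt_id' y).const_mul M.mu).exp
  have h1 := M.hasDerivAt_solvedPrimitive y
  have h2 := M.hasDerivAt_survivalPrimitive y
  have h := ((((h0.mul (M.hasDerivAt_unsolved y)).mul_const (M.mu * M.V τ - M.c)).add
    (((h1.const_mul (M.B * M.lam * M.pbar)).sub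
      (h2.const_mul (M.mu * M.V τ))).const_mul M.mu)).sub
    (h2.const_mul (M.mu * derivWithin M.V (Ici 0) τ))).const_mul (Real.exp (-M.mu * (T - τ)))
  refine HasDerivAt.congr_deriv h ?_
  have e1 : Real.exp ((M.mu - M.lam) * y) =
      Real.exp (M.mu * y) * Real.exp (-M.lam * y) := by
    rw [← Real.exp_add]; ring_nf
  rw [e1, swapGain]
  field_simp
  ring

theorem strictAntiOn_reducedFlow (hmu : 0 < M.mu) {τ y₀ : ℝ}
    (h : ∀ y, y₀ < y → 0 < M.swapGain τ y) (T : ℝ) :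
    StrictAntiOn (M.reducedFlow T τ) (Ici y₀) := by
  refine strictAntiOn_of_deriv_neg (convex_Ici y₀)
    (fun y _ => (hasDerivAt_reducedFlow hmu T τ y).continuousAt.continuousWithinAt) ?_
  intro y hy
  rw [interior_Ici] at hy
  rw [(hasDerivAt_reducedFlow hmu T τ y).deriv, neg_lt_zero]
  have := h y hy
  positivity

/-! ### Postponing doing -/

/-- The policy that follows `a` until `s` remains, and then thinks until `k` remains before
switching to doing for good. -/
def delay (a : ℝ → ℝ) (k s τ : ℝ) : ℝ := if τ ≤ k then 1 else if τ ≤ s then 0 else a τ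

theorem IsPolicy.delay (ha : IsPolicy T a) (k s : ℝ) : IsPolicy T (delay a k s) := by
  refine ⟨Measurable.ite measurableSet_Iic measurable_const
    (Measurable.ite measurableSet_Iic measurable_const ha.1), fun τ hτ => ?_⟩
  unfold ThinkDo.delay
  split_ifs
  · simp
  · simp
  · exact ha.2 τ hτ

theorem pastDoing_delay_of_ge {k s τ : ℝ} (hks : k ≤ s) (hs : s ≤ τ) (hτ : τ ≤ T) :
    pastDoing T (delay a k s) τ = pastDoing T a τ := by
  unfold pastDoing
  refine intervalIntegral.integral_congr_ae (Eventually.of_forall fun x hx => ?_)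
  rw [uIoc_of_le hτ] at hx
  have h1 : ¬ x ≤ k := by linarith [hx.1]
  have h2 : ¬ x ≤ s := by linarith [hx.1]
  simp [delay, h1, h2]

theorem IsPolicy.pastDoing_delay_of_le (ha : IsPolicy T a) {k s τ : ℝ} (hk : 0 ≤ k)
    (hks : k ≤ s) (hs : s ≤ T) (hτ0 : 0 ≤ τ) (hτ : τ ≤ s) :
    pastDoing T (ThinkDo.delay a k s) τ = pastDoing T a s + max 0 (k - τ) := by
  have hb := ha.delay k s
  have hsm : s ∈ Icc 0 T := ⟨hk.trans hks, hs⟩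
  have hkm : k ∈ Icc 0 T := ⟨hk, hks.trans hs⟩
  have hτm : τ ∈ Icc 0 T := ⟨hτ0, hτ.trans hs⟩
  have h1 := hb.pastDoing_sub hτm hsm
  rw [pastDoing_delay_of_ge hks le_rfl hs] at h1
  have hzero : ∀ x, k ≤ x → x ≤ s → ∫ u in x..s, ThinkDo.delay a k s u = 0 := by
    intro x hx hxs
    refine intervalIntegral.integral_zero_ae (Eventually.of_forall fun u hu => ?_)
    rw [uIoc_of_le hxs] at hu
    have h1 : ¬ u ≤ k := by linarith [hu.1]
    simp [ThinkDo.delay, h1, hu.2]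
  rcases le_total k τ with h | h
  · rw [max_eq_left (by linarith)]
    linarith [hzero τ h hτ]
  · rw [max_eq_right (by linarith)]
    have h2 : ∫ u in τ..k, ThinkDo.delay a k s u = ∫ u in τ..k, (1 : ℝ) := by
      refine intervalIntegral.integral_congr_ae (Eventually.of_forall fun u hu => ?_)
      rw [uIoc_of_le h] at hu
      simp [ThinkDo.delay, hu.2]
    rw [← intervalIntegral.integral_add_adjacent_intervals (hb.intervalIntegrable hτm hkm)
      (hb.intervalIntegrable hkm hsm), hzero k le_rfl hks, h2] at h1
    simp at h1
    linarith

/-- Where swapping is profitable, postponing doing raises the payoff, strictly so unless the policy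
already postpones. -/
theorem IsPolicy.payoff_delay (ha : IsPolicy T a) (hp : M.pbar ∈ Ioo (0 : ℝ) 1) (hmu : 0 < M.mu)
    (hV : ContDiffOn ℝ 1 M.V (Ici 0)) {s : ℝ} (hs : s ∈ Icc 0 T)
    (hgain : ∀ τ ∈ Icc 0 T, ∀ y, pastDoing T a s < y → 0 < M.swapGain τ y) :
    M.payoff T a ≤ M.payoff T (ThinkDo.delay a (pastDoing T a 0 - pastDoing T a s) s) ∧
    (M.payoff T (ThinkDo.delay a (pastDoing T a 0 - pastDoing T a s) s) ≤ M.payoff T a →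
      ∀ τ ∈ Icc 0 s, pastDoing T a τ =
        pastDoing T a s + max 0 (pastDoing T a 0 - pastDoing T a s - τ)) := by
  have hT : 0 ≤ T := hs.1.trans hs.2
  have h0 : (0 : ℝ) ∈ Icc 0 T := ⟨le_rfl, hT⟩
  set k := pastDoing T a 0 - pastDoing T a s with hk
  have hk0 : 0 ≤ k := ha.pastDoing_sub_nonneg h0 hs hs.1
  have hks : k ≤ s := (ha.pastDoing_sub_le h0 hs hs.1).trans_eq (sub_zero s)
  have hb := ha.delay k s
  -- The delayed path is the lower envelope: past effort is at least its value at `s` by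
  -- monotonicity, and at least its final value minus `τ` because its slope is at most one.
  have hlow : ∀ τ ∈ Icc 0 s, pastDoing T a s + max 0 (k - τ) ≤ pastDoing T a τ := by
    intro τ hτ
    have hτm : τ ∈ Icc 0 T := ⟨hτ.1, hτ.2.trans hs.2⟩
    have h1 := ha.pastDoing_sub_nonneg hτm hs hτ.2
    have h2 := ha.pastDoing_sub_le h0 hτm hτ.1
    rcases le_total 0 (k - τ) with h | h
    · rw [max_eq_right h]; linarith
    · rw [max_eq_left h]; linarith
  have hanti : ∀ τ ∈ Icc 0 T, StrictAntiOn (M.reducedFlow T τ) (Ici (pastDoing T a s)) :=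
    fun τ hτ => strictAntiOn_reducedFlow hmu (hgain τ hτ) T
  -- Equal total effort makes the potential terms of the two payoffs coincide.
  have hzero : pastDoing T (ThinkDo.delay a k s) 0 = pastDoing T a 0 := by
    rw [ha.pastDoing_delay_of_le hk0 hks hs.2 le_rfl hs.1, max_eq_right (by linarith)]
    linarith
  have hle : ∀ τ ∈ Icc 0 T, M.reducedFlow T τ (pastDoing T a τ) ≤
      M.reducedFlow T τ (pastDoing T (ThinkDo.delay a k s) τ) := by
    intro τ hτ
    rcases le_total s τ with h | h
    · rw [pastDoing_delay_of_ge hks h hτ.2]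
    · rw [ha.pastDoing_delay_of_le hk0 hks hs.2 hτ.1 h]
      have h1 := hlow τ ⟨hτ.1, h⟩
      have h2 : pastDoing T a s ≤ pastDoing T a s + max 0 (k - τ) := by
        linarith [le_max_left 0 (k - τ)]
      exact (hanti τ hτ).antitoneOn h2 (h2.trans h1) h1
  have ca := continuousOn_reducedFlow ha hV
  have cb := continuousOn_reducedFlow hb hV
  rw [ha.payoff_eq hT hp hV, hb.payoff_eq hT hp hV, hzero, add_le_add_iff_left,
    add_le_add_iff_left]
  refine ⟨intervalIntegral.integral_mono_on hT (ca.intervalIntegrable_of_Icc hT)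
    (cb.intervalIntegrable_of_Icc hT) hle, fun hge τ hτ => ?_⟩
  have hτm : τ ∈ Icc 0 T := ⟨hτ.1, hτ.2.trans hs.2⟩
  have h1 := hlow τ hτ
  by_contra hne
  have hlt := lt_of_le_of_ne h1 (Ne.symm hne)
  have hTpos : 0 < T := by
    refine lt_of_le_of_ne hT fun h => hne ?_
    have hτ0 : τ = 0 := le_antisymm (h ▸ hτm.2) hτm.1
    have hs0 : s = 0 := le_antisymm (h ▸ hs.2) hs.1
    rw [hk, hτ0, hs0]; simp
  refine absurd hge (not_le.2 ?_)
  -- Both reduced flows are continuous in `τ`, so strictness at one date makes the integrals differ.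
  refine intervalIntegral.integral_lt_integral_of_continuousOn_of_le_of_exists_lt hTpos ca cb
    (fun x hx => hle x ⟨hx.1.le, hx.2⟩) ⟨τ, hτm, ?_⟩
  rw [ha.pastDoing_delay_of_le hk0 hks hs.2 hτ.1 hτ.2]
  have h2 : pastDoing T a s ≤ pastDoing T a s + max 0 (k - τ) := by
    linarith [le_max_left 0 (k - τ)]
  exact (hanti τ hτm) h2 (h2.trans h1) hlt

theorem IsPolicy.ae_eq_one (ha : IsPolicy T a) {k : ℝ} (hk : k ∈ Icc 0 T)
    (h : pastDoing T a 0 - pastDoing T a k = k) : ∀ᵐ τ, τ ∈ Ioc 0 k → a τ = 1 := by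
  have h0 : (0 : ℝ) ∈ Icc 0 T := ⟨le_rfl, hk.1.trans hk.2⟩
  have hi := ha.intervalIntegrable h0 hk
  rw [ha.pastDoing_sub h0 hk] at h
  have hz : ∫ τ in (0 : ℝ)..k, (1 - a τ) = 0 := by
    rw [intervalIntegral.integral_sub intervalIntegrable_const hi, h]; simp
  have hnn : 0 ≤ᵐ[volume.restrict (Ioc 0 k)] fun τ => 1 - a τ := by
    refine (ae_restrict_iff' measurableSet_Ioc).2 (Eventually.of_forall fun τ hτ => ?_)
    simpa using (ha.2 τ ⟨hτ.1.le, hτ.2.trans hk.2⟩).2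
  have := (intervalIntegral.integral_eq_zero_iff_of_le_of_nonneg_ae hk.1 hnn
    (intervalIntegrable_const.sub hi)).1 hz
  filter_upwards [(ae_restrict_iff' measurableSet_Ioc).1 this] with τ hτ hm
  have := hτ hm
  simp only [Pi.zero_apply] at this
  linarith

theorem IsPolicy.ae_eq_zero (ha : IsPolicy T a) {k : ℝ} (hk : k ∈ Icc 0 T)
    (h : pastDoing T a k = 0) : ∀ᵐ τ, τ ∈ Ioc k T → a τ = 0 := by
  have hT : T ∈ Icc 0 T := ⟨hk.1.trans hk.2, le_rfl⟩
  have hi := ha.intervalIntegrable hk hT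
  have hnn : 0 ≤ᵐ[volume.restrict (Ioc k T)] a := by
    refine (ae_restrict_iff' measurableSet_Ioc).2 (Eventually.of_forall fun τ hτ => ?_)
    exact (ha.2 τ ⟨hk.1.trans hτ.1.le, hτ.2⟩).1
  exact (ae_restrict_iff' measurableSet_Ioc).1
    ((intervalIntegral.integral_eq_zero_iff_of_le_of_nonneg_ae hk.2 hnn hi).1 h)

/-- Under an optimal policy, thinking happens only before the belief enters the region where
swapping is profitable. -/
theorem IsOptimal.ae_pastDoing_le (ha : M.IsOptimal T a) (hp : M.pbar ∈ Ioo (0 : ℝ) 1)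
    (hmu : 0 < M.mu) (hV : ContDiffOn ℝ 1 M.V (Ici 0)) {s : ℝ} (hs : s ∈ Icc 0 T)
    (hgain : ∀ τ ∈ Icc 0 T, ∀ y, pastDoing T a s < y → 0 < M.swapGain τ y) :
    ∀ᵐ τ ∂(volume.restrict (Icc 0 T)), a τ < 1 → pastDoing T a τ ≤ pastDoing T a s := by
  have h0 : (0 : ℝ) ∈ Icc 0 T := ⟨le_rfl, hs.1.trans hs.2⟩
  have heq := (ha.1.payoff_delay hp hmu hV hs hgain).2 (ha.2 _ (ha.1.delay _ _))
  set k := pastDoing T a 0 - pastDoing T a s with hk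
  have hk0 : 0 ≤ k := ha.1.pastDoing_sub_nonneg h0 hs hs.1
  have hks : k ≤ s := (ha.1.pastDoing_sub_le h0 hs hs.1).trans_eq (sub_zero s)
  -- At `τ = k` the path has come back to its value at `s`; hence all `k` units of remaining effort
  -- fall in the last `k` of time, forcing share one there.
  have hAk := heq k ⟨hk0, hks⟩
  simp only [sub_self, max_self, add_zero] at hAk
  have hone := ha.1.ae_eq_one ⟨hk0, hks.trans hs.2⟩ (by rw [hAk])
  have hne : ∀ᵐ τ : ℝ, τ ≠ 0 := by simp [ae_iff]
  refine (ae_restrict_iff' measurableSet_Icc).2 ?_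
  filter_upwards [hone, hne] with τ h1 h2 hτ hlt
  have hkτ : k < τ := by
    by_contra hcon
    exact hlt.ne (h1 ⟨lt_of_le_of_ne hτ.1 (Ne.symm h2), not_lt.1 hcon⟩)
  rcases le_total s τ with h | h
  · linarith [ha.1.pastDoing_sub_nonneg hs hτ h]
  · rw [heq τ ⟨hτ.1, h⟩, max_eq_left (by linarith), add_zero]

/-! ### Sign of the swap gain in terms of the belief -/

/-- The standing assumptions on the primitives. -/
structure Regular (M : ThinkDo) (Vinf : ℝ) : Prop where
  pbar_mem : M.pbar ∈ Ioo (0 : ℝ) 1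
  lam_pos : 0 < M.lam
  mu_pos : 0 < M.mu
  B_pos : 0 < M.B
  c_pos : 0 < M.c
  smooth : ContDiffOn ℝ 3 M.V (Ici 0)
  value_zero : M.V 0 = 0
  incr : ∀ τ ∈ Ici (0 : ℝ), 0 < derivWithin M.V (Ici 0) τ
  conc : ∀ τ ∈ Ici (0 : ℝ),
    M.pbar * M.lam ≤ -iteratedDerivWithin 2 M.V (Ici 0) τ / derivWithin M.V (Ici 0) τ
  lim : Tendsto M.V atTop (𝓝 Vinf)
  lim_le : Vinf ≤ M.B + M.c / M.mu

variable (M) in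
/-- The belief after `y` units of doing effort without a solution. -/
def beliefAfter (y : ℝ) : ℝ :=
  M.pbar * Real.exp (-M.lam * y) / (M.pbar * Real.exp (-M.lam * y) + (1 - M.pbar))

variable (M) in
/-- The rate at which delaying doing raises the payoff, at remaining time `τ` and belief `p`. -/
def beliefGain (τ p : ℝ) : ℝ :=
  M.c + derivWithin M.V (Ici 0) τ - M.lam * p * (M.B + M.c / M.mu - M.V τ)

theorem unsolved_pos (hp : M.pbar ∈ Ioo (0 : ℝ) 1) (y : ℝ) : 0 < M.unsolved y := by
  have := mul_pos hp.1 (Real.exp_pos (-M.lam * y))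
  unfold unsolved
  linarith [hp.2]

theorem beliefAfter_eq (y : ℝ) :
    M.beliefAfter y = M.pbar * Real.exp (-M.lam * y) / M.unsolved y := by
  rw [beliefAfter, unsolved, add_comm (1 - M.pbar)]

theorem swapGain_eq (hp : M.pbar ∈ Ioo (0 : ℝ) 1) (τ y : ℝ) :
    M.swapGain τ y = M.unsolved y * M.beliefGain τ (M.beliefAfter y) := by
  have h := (unsolved_pos hp y).ne'
  have e : M.pbar * Real.exp (-M.lam * y) = M.unsolved y * M.beliefAfter y := by
    rw [beliefAfter_eq]; field_simp
  rw [swapGain, beliefGain, e]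
  ring

theorem beliefAfter_zero : M.beliefAfter 0 = M.pbar := by simp [beliefAfter]

theorem strictAnti_beliefAfter (hp : M.pbar ∈ Ioo (0 : ℝ) 1) (hlam : 0 < M.lam) :
    StrictAnti M.beliefAfter := by
  intro x y hxy
  rw [beliefAfter_eq, beliefAfter_eq, div_lt_div_iff₀ (unsolved_pos hp y) (unsolved_pos hp x)]
  have he : Real.exp (-M.lam * y) < Real.exp (-M.lam * x) :=
    Real.exp_lt_exp.2 (by nlinarith)
  have := mul_lt_mul_of_pos_left he (mul_pos hp.1 (sub_pos.2 hp.2))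
  unfold unsolved
  nlinarith

theorem belief_eq (T : ℝ) (a : ℝ → ℝ) (τ : ℝ) :
    M.belief T a τ = M.beliefAfter (pastDoing T a τ) := rfl

theorem continuous_beliefAfter (hp : M.pbar ∈ Ioo (0 : ℝ) 1) : Continuous M.beliefAfter := by
  have : M.beliefAfter = fun y => M.pbar * Real.exp (-M.lam * y) / M.unsolved y :=
    funext beliefAfter_eq
  rw [this]
  exact (by fun_prop : Continuous fun y => M.pbar * Real.exp (-M.lam * y)).div
    continuous_unsolved fun y => (unsolved_pos hp y).ne'

namespace Regular

theorem contDiffOn_one (h : Regular M Vinf) : ContDiffOn ℝ 1 M.V (Ici 0) :=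
  h.smooth.of_le (by norm_num)

theorem strictMonoOn_value (h : Regular M Vinf) : StrictMonoOn M.V (Ici 0) := by
  refine strictMonoOn_of_deriv_pos (convex_Ici 0) h.smooth.continuousOn fun τ hτ => ?_
  rw [interior_Ici] at hτ
  rw [(hasDerivAt_value h.contDiffOn_one hτ).deriv]
  exact h.incr τ (mem_Ici.2 (le_of_lt hτ))

theorem value_lt (h : Regular M Vinf) {τ : ℝ} (hτ : 0 ≤ τ) : M.V τ < Vinf := by
  have h1 : M.V τ < M.V (τ + 1) :=
    h.strictMonoOn_value hτ (show (0 : ℝ) ≤ τ + 1 by linarith) (by linarith)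
  refine h1.trans_le (ge_of_tendsto h.lim ?_)
  filter_upwards [eventually_ge_atTop (τ + 1)] with x hx
  exact h.strictMonoOn_value.monotoneOn (show (0 : ℝ) ≤ τ + 1 by linarith)
    (show (0 : ℝ) ≤ x by linarith) hx

theorem margin_pos (h : Regular M Vinf) {τ : ℝ} (hτ : 0 ≤ τ) :
    0 < M.B + M.c / M.mu - M.V τ := by
  linarith [h.value_lt hτ, h.lim_le]

theorem contDiffOn_derivWithin (h : Regular M Vinf) :
    ContDiffOn ℝ 2 (derivWithin M.V (Ici 0)) (Ici 0) :=
  h.smooth.derivWithin (uniqueDiffOn_Ici 0) (by norm_num)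

theorem hasDerivAt_derivWithin (h : Regular M Vinf) {τ : ℝ} (hτ : 0 < τ) :
    HasDerivAt (derivWithin M.V (Ici 0)) (iteratedDerivWithin 2 M.V (Ici 0) τ) τ := by
  have e : iteratedDerivWithin 2 M.V (Ici 0) τ =
      derivWithin (derivWithin M.V (Ici 0)) (Ici 0) τ := by
    rw [iteratedDerivWithin_succ, iteratedDerivWithin_one]
  rw [e]
  exact ((h.contDiffOn_derivWithin.differentiableOn two_ne_zero) τ
    hτ.le).hasDerivWithinAt.hasDerivAt (Ici_mem_nhds hτ)

theorem second_le (h : Regular M Vinf) {τ : ℝ} (hτ : 0 ≤ τ) :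
    iteratedDerivWithin 2 M.V (Ici 0) τ ≤ -(M.pbar * M.lam * derivWithin M.V (Ici 0) τ) := by
  have := (le_div_iff₀ (h.incr τ hτ)).1 (h.conc τ hτ)
  linarith

theorem hasDerivAt_beliefGain (h : Regular M Vinf) (p : ℝ) {τ : ℝ} (hτ : 0 < τ) :
    HasDerivAt (fun τ => M.beliefGain τ p)
      (iteratedDerivWithin 2 M.V (Ici 0) τ + M.lam * p * derivWithin M.V (Ici 0) τ) τ := by
  have := ((h.hasDerivAt_derivWithin hτ).const_add M.c).sub
    (((hasDerivAt_value h.contDiffOn_one hτ).const_sub (M.B + M.c / M.mu)).const_mul (M.lam * p))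
  exact this.congr_deriv (by ring)

theorem continuousOn_beliefGain (h : Regular M Vinf) (p : ℝ) :
    ContinuousOn (fun τ => M.beliefGain τ p) (Ici 0) := by
  have h1 := h.smooth.continuousOn
  have h2 := h.contDiffOn_derivWithin.continuousOn
  unfold beliefGain
  fun_prop

/-- The derivative in `τ` is `V'' + λ p V'`, nonpositive for `p ≤ pbar` exactly by the curvature
condition. -/
theorem antitoneOn_beliefGain (h : Regular M Vinf) {p : ℝ} (hp : p ≤ M.pbar) :
    AntitoneOn (fun τ => M.beliefGain τ p) (Ici 0) := by
  refine antitoneOn_of_deriv_nonpos (convex_Ici 0) (h.continuousOn_beliefGain p)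
    (fun τ hτ => ?_) fun τ hτ => ?_ <;> rw [interior_Ici] at hτ
  · exact (h.hasDerivAt_beliefGain p hτ).differentiableAt.differentiableWithinAt
  · rw [(h.hasDerivAt_beliefGain p hτ).deriv]
    have h1 := h.second_le (le_of_lt hτ)
    have h2 := mul_nonneg (mul_nonneg h.lam_pos.le (sub_nonneg.2 hp)) (h.incr τ (mem_Ici.2 (le_of_lt hτ))).le
    linarith

theorem strictAntiOn_beliefGain (h : Regular M Vinf) {p : ℝ} (hp : p < M.pbar) :
    StrictAntiOn (fun τ => M.beliefGain τ p) (Ici 0) := by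
  refine strictAntiOn_of_deriv_neg (convex_Ici 0) (h.continuousOn_beliefGain p) fun τ hτ => ?_
  rw [interior_Ici] at hτ
  rw [(h.hasDerivAt_beliefGain p hτ).deriv]
  have h1 := h.second_le (le_of_lt hτ)
  have h2 := mul_pos (mul_pos h.lam_pos (sub_pos.2 hp)) (h.incr τ (mem_Ici.2 (le_of_lt hτ)))
  linarith

/-- Compare with a later time `x`, drop `V' x > 0`, and let `x` tend to infinity; no limit of `V'`
is needed. -/
theorem beliefGain_ge (h : Regular M Vinf) {p τ : ℝ} (hp : p ≤ M.pbar) (hτ : 0 ≤ τ) :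
    M.c - M.lam * p * (M.B + M.c / M.mu - Vinf) ≤ M.beliefGain τ p := by
  have ht : Tendsto (fun x => M.c - M.lam * p * (M.B + M.c / M.mu - M.V x)) atTop
      (𝓝 (M.c - M.lam * p * (M.B + M.c / M.mu - Vinf))) :=
    ((h.lim.const_sub _).const_mul _).const_sub _
  refine le_of_tendsto ht ?_
  filter_upwards [eventually_ge_atTop τ] with x hx
  refine le_trans ?_ (h.antitoneOn_beliefGain hp hτ (hτ.trans hx) hx)
  have := h.incr x (hτ.trans hx)
  simp only [beliefGain]
  linarith

theorem beliefGain_strictAnti (h : Regular M Vinf) {p p' τ : ℝ} (hτ : 0 ≤ τ) (hp : p < p') :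
    M.beliefGain τ p' < M.beliefGain τ p := by
  have := mul_pos (mul_pos h.lam_pos (sub_pos.2 hp)) (h.margin_pos hτ)
  unfold beliefGain
  linarith

theorem gain_pbar_nonneg (h : Regular M Vinf) (hle : (M.pbar : EReal) ≤ M.pHat Vinf) {τ : ℝ}
    (hτ : 0 ≤ τ) : 0 ≤ M.beliefGain τ M.pbar := by
  refine le_trans ?_ (h.beliefGain_ge le_rfl hτ)
  unfold pHat at hle
  have hl := h.lam_pos
  have hc := h.c_pos
  split_ifs at hle with hD
  · rw [EReal.coe_le_coe_iff, le_div_iff₀ hD, le_div_iff₀ hl] at hle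
    linarith
  · have := mul_nonneg (mul_nonneg hl.le h.pbar_mem.1.le)
      (by linarith : 0 ≤ -(M.B + M.c / M.mu - Vinf))
    linarith

theorem swapGain_pos_of_le (h : Regular M Vinf) (hle : (M.pbar : EReal) ≤ M.pHat Vinf) {τ y : ℝ}
    (hτ : 0 ≤ τ) (hy : 0 < y) : 0 < M.swapGain τ y := by
  rw [swapGain_eq h.pbar_mem]
  refine mul_pos (unsolved_pos h.pbar_mem y) ?_
  refine (h.gain_pbar_nonneg hle hτ).trans_lt (h.beliefGain_strictAnti hτ ?_)
  have := strictAnti_beliefAfter h.pbar_mem h.lam_pos hy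
  rwa [beliefAfter_zero] at this

/-! ### Beliefs during the thinking phase -/

theorem ae_belief_of_le (h : Regular M Vinf) (hle : (M.pbar : EReal) ≤ M.pHat Vinf)
    (hT : 0 ≤ T) (ha : M.IsOptimal T a) :
    ∀ᵐ τ ∂(volume.restrict (Icc 0 T)), a τ < 1 → M.belief T a τ = M.pbar := by
  have := ha.ae_pastDoing_le h.pbar_mem h.mu_pos h.contDiffOn_one (s := T) ⟨hT, le_rfl⟩
    fun τ hτ y hy => h.swapGain_pos_of_le hle hτ.1 (by rwa [pastDoing_self] at hy)
  filter_upwards [this, ae_restrict_mem measurableSet_Icc] with τ h1 h2 hlt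
  have h3 := h1 hlt
  rw [pastDoing_self] at h3
  rw [belief_eq, le_antisymm h3 (ha.1.pastDoing_mem h2).1, beliefAfter_zero]

/-- The gain at `r` is strictly positive at every finite time, which leaves room for a slightly
larger `r'`. Delaying from the date when the belief equals `r'` keeps thinking at beliefs of at
least `r'`. -/
theorem ae_lt_belief (h : Regular M Vinf) {r : ℝ} (hr : r < M.pbar)
    (hc : M.lam * r * (M.B + M.c / M.mu - Vinf) ≤ M.c)
    (hT : 0 ≤ T) (ha : M.IsOptimal T a) :
    ∀ᵐ τ ∂(volume.restrict (Icc 0 T)), a τ < 1 → r < M.belief T a τ := by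
  have h0 : (0 : ℝ) ∈ Icc 0 T := ⟨le_rfl, hT⟩
  have hanti := strictAnti_beliefAfter h.pbar_mem h.lam_pos
  by_cases hb : r < M.belief T a 0
  · filter_upwards [ae_restrict_mem measurableSet_Icc] with τ hτ _
    refine hb.trans_le (hanti.antitone ?_)
    linarith [ha.1.pastDoing_sub_nonneg h0 hτ hτ.1]
  -- The strict decrease from `T` to `T + 1` turns the weak bound into a strict one.
  have hgain : 0 < M.beliefGain T r := by
    have h1 := h.beliefGain_ge hr.le (show 0 ≤ T + 1 by linarith)
    have h2 := h.strictAntiOn_beliefGain hr hT (show (0 : ℝ) ≤ T + 1 by linarith)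
      (by linarith)
    simp only at h2
    linarith
  have hU := mul_pos h.lam_pos (h.margin_pos hT)
  -- The second entry of the minimum is the zero of the gain at time `T` as a function of the
  -- belief.
  obtain ⟨r', hr1, hr2⟩ : ∃ r', r < r' ∧ r' < min M.pbar
      ((M.c + derivWithin M.V (Ici 0) T) / (M.lam * (M.B + M.c / M.mu - M.V T))) := by
    refine exists_between (lt_min hr ((lt_div_iff₀ hU).2 ?_))
    unfold beliefGain at hgain
    linarith
  have hr3 : r' < M.pbar := hr2.trans_le (min_le_left _ _)
  have hgain' : 0 < M.beliefGain T r' := by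
    have := (lt_div_iff₀ hU).1 (hr2.trans_le (min_le_right _ _))
    unfold beliefGain
    linarith
  have hcont : ContinuousOn (M.belief T a) (Icc 0 T) :=
    (continuous_beliefAfter h.pbar_mem).comp_continuousOn ha.1.lipschitzOnWith.continuousOn
  obtain ⟨s, hs, hsr⟩ : ∃ s ∈ Icc 0 T, M.belief T a s = r' := by
    refine intermediate_value_Icc hT hcont ⟨(not_lt.1 hb).trans hr1.le, ?_⟩
    rw [belief_eq, pastDoing_self, beliefAfter_zero]
    exact hr3.le
  have := ha.ae_pastDoing_le h.pbar_mem h.mu_pos h.contDiffOn_one hs fun τ hτ y hy => by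
    rw [swapGain_eq h.pbar_mem]
    refine mul_pos (unsolved_pos h.pbar_mem y) ?_
    have hyr : M.beliefAfter y < r' := hsr ▸ hanti hy
    exact hgain'.trans ((h.beliefGain_strictAnti hT hyr).trans_le
      (h.antitoneOn_beliefGain (hyr.trans hr3).le hτ.1 hT hτ.2))
  filter_upwards [this] with τ h1 hlt
  refine hr1.trans_le (hsr ▸ ?_)
  exact hanti.antitone (h1 hlt)

theorem thinking_belief (h : Regular M Vinf) (hT : 0 ≤ T) (ha : M.IsOptimal T a) :
    ∀ᵐ τ ∂(volume.restrict (Icc 0 T)), a τ < 1 →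
      min (M.pHat Vinf) (M.pbar : EReal) ≤ (M.belief T a τ : EReal) ∧
      (M.pHat Vinf < (M.pbar : EReal) → M.pHat Vinf < (M.belief T a τ : EReal)) := by
  rcases le_or_gt (M.pbar : EReal) (M.pHat Vinf) with hle | hlt
  · filter_upwards [h.ae_belief_of_le hle hT ha] with τ h1 h2
    rw [h1 h2]
    exact ⟨min_le_right _ _, fun h3 => absurd h3 (not_lt.2 hle)⟩
  · have hD : 0 < M.B - Vinf + M.c / M.mu := by
      by_contra hD
      rw [pHat, if_neg hD] at hlt
      exact not_top_lt hlt
    have hl := h.lam_pos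
    rw [pHat, if_pos hD] at hlt ⊢
    have hr := EReal.coe_lt_coe_iff.1 hlt
    have hc : M.lam * (M.c / M.lam / (M.B - Vinf + M.c / M.mu)) * (M.B + M.c / M.mu - Vinf)
        ≤ M.c := by
      have e : M.B + M.c / M.mu - Vinf = M.B - Vinf + M.c / M.mu := by ring
      rw [e, mul_assoc, div_mul_cancel₀ _ hD.ne', mul_div_cancel₀ _ hl.ne']
    filter_upwards [h.ae_lt_belief hr hc hT ha] with τ h1 h2
    have h3 := EReal.coe_lt_coe_iff.2 (h1 h2)
    exact ⟨(min_le_left _ _).trans h3.le, fun _ => h3⟩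

end Regular

/-! ### Policies with a single switch -/

theorem integral_eq_add_of_ae {f g₁ g₂ : ℝ → ℝ} {k T : ℝ} (hk : k ∈ Icc 0 T)
    (h₁ : ∀ᵐ τ, τ ∈ Ioc 0 k → f τ = g₁ τ) (h₂ : ∀ᵐ τ, τ ∈ Ioc k T → f τ = g₂ τ)
    (c₁ : Continuous g₁) (c₂ : Continuous g₂) :
    ∫ τ in (0 : ℝ)..T, f τ = (∫ τ in (0 : ℝ)..k, g₁ τ) + ∫ τ in k..T, g₂ τ := by
  rw [← uIoc_of_le hk.1] at h₁
  rw [← uIoc_of_le hk.2] at h₂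
  have i₁ : IntervalIntegrable f volume 0 k :=
    (c₁.intervalIntegrable 0 k).congr_ae ((ae_restrict_iff' measurableSet_uIoc).2
      (h₁.mono fun τ h hτ => (h hτ).symm))
  have i₂ : IntervalIntegrable f volume k T :=
    (c₂.intervalIntegrable k T).congr_ae ((ae_restrict_iff' measurableSet_uIoc).2
      (h₂.mono fun τ h hτ => (h hτ).symm))
  rw [← intervalIntegral.integral_add_adjacent_intervals i₁ i₂,
    intervalIntegral.integral_congr_ae h₁, intervalIntegral.integral_congr_ae h₂]

variable (M) in
/-- The value of doing for the remaining time `k`. -/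
def doValue (k : ℝ) : ℝ :=
  (M.B - M.c / M.lam) * M.pbar * (1 - Real.exp (-M.lam * k)) - M.c * (1 - M.pbar) * k

variable (M) in
/-- The payoff from thinking until `k` remains and doing afterwards. -/
def switchPayoff (T k : ℝ) : ℝ :=
  (∫ τ in k..T, Real.exp (-M.mu * (T - τ)) * (M.mu * M.V (max 0 τ) - M.c)) +
    Real.exp (-M.mu * (T - k)) * M.doValue k

variable (M) in
/-- The marginal gain, up to discounting, from switching to doing slightly before `k` remains. -/
def switchGain (k : ℝ) : ℝ :=
  M.pbar * (M.mu * (M.B + M.c * k) +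
      (M.lam - M.mu) * (M.B - (1 - Real.exp (-M.lam * k)) * (M.B - M.c / M.lam))) -
    M.mu * (M.V k + M.c * k)

/-- The policy `a` thinks until `k` remains and then does, up to null sets. -/
def SwitchesAt (T : ℝ) (a : ℝ → ℝ) (k : ℝ) : Prop :=
  ∀ τ ∈ Icc 0 T, pastDoing T a τ = max 0 (k - τ)

theorem SwitchesAt.ae_eq_one (h : SwitchesAt T a k) (ha : IsPolicy T a) (hk : k ∈ Icc 0 T) :
    ∀ᵐ τ, τ ∈ Ioc 0 k → a τ = 1 := by
  refine ha.ae_eq_one hk ?_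
  rw [h k hk, h 0 ⟨le_rfl, hk.1.trans hk.2⟩]
  simp [hk.1]

theorem SwitchesAt.ae_eq_zero (h : SwitchesAt T a k) (ha : IsPolicy T a) (hk : k ∈ Icc 0 T) :
    ∀ᵐ τ, τ ∈ Ioc k T → a τ = 0 := by
  refine ha.ae_eq_zero hk ?_
  rw [h k hk]
  simp

theorem hasDerivAt_exp_sub (l k τ : ℝ) :
    HasDerivAt (fun τ => Real.exp (-l * (k - τ))) (l * Real.exp (-l * (k - τ))) τ :=
  (((hasDerivAt_id' τ).const_sub k).const_mul (-l)).exp.congr_deriv (by ring)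

theorem SwitchesAt.doingProb_eq (h : SwitchesAt T a k) (ha : IsPolicy T a) (hk : k ∈ Icc 0 T)
    (hp : M.pbar ∈ Ioo (0 : ℝ) 1) :
    M.doingProb T a =
      Real.exp (-M.mu * (T - k)) * (M.pbar * (1 - Real.exp (-M.lam * k))) := by
  unfold doingProb
  rw [integral_eq_add_of_ae (k := k)
    (g₁ := fun τ => Real.exp (-M.mu * (T - k)) * M.pbar *
      (M.lam * Real.exp (-M.lam * (k - τ)))) (g₂ := fun _ => 0) hk ?_ ?_ (by fun_prop)
      (by fun_prop)]
  · rw [intervalIntegral.integral_eq_sub_of_hasDerivAt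
      (f := fun τ => Real.exp (-M.mu * (T - k)) * M.pbar * Real.exp (-M.lam * (k - τ)))
      (fun τ _ => (hasDerivAt_exp_sub M.lam k τ).const_mul _)
      (Continuous.intervalIntegrable (by fun_prop) _ _)]
    simp
    ring
  · filter_upwards [h.ae_eq_one ha hk] with τ h1 hτ
    have e := M.noSolution_mul_belief hp T a τ
    have hA : pastDoing T a τ = k - τ := by
      rw [h τ ⟨hτ.1.le, hτ.2.trans hk.2⟩, max_eq_right (by linarith [hτ.2])]
    have e2 : M.noProgress T a τ = Real.exp (-M.mu * (T - k)) := by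
      rw [noProgress, hA]; congr 1; ring
    calc _ = M.noProgress T a τ * M.lam * a τ * (M.noSolution T a τ * M.belief T a τ) := by ring
      _ = _ := by rw [e, e2, hA, h1 hτ]; ring
  · filter_upwards [h.ae_eq_zero ha hk] with τ h1 hτ
    rw [h1 hτ]
    ring

theorem SwitchesAt.payoff_eq (h : SwitchesAt T a k) (ha : IsPolicy T a) (hk : k ∈ Icc 0 T)
    (hp : M.pbar ∈ Ioo (0 : ℝ) 1) (hlam : 0 < M.lam) (hV : ContinuousOn M.V (Ici 0)) :
    M.payoff T a = M.switchPayoff T k := by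
  have hVc : Continuous fun τ => M.V (max 0 τ) :=
    hV.comp_continuous (by fun_prop) fun τ => le_max_left 0 τ
  unfold payoff switchPayoff
  rw [integral_eq_add_of_ae (k := k)
    (g₁ := fun τ => Real.exp (-M.mu * (T - k)) *
      ((M.B - M.c / M.lam) * M.pbar * (M.lam * Real.exp (-M.lam * (k - τ))) -
        M.c * (1 - M.pbar) * 1))
    (g₂ := fun τ => Real.exp (-M.mu * (T - τ)) * (M.mu * M.V (max 0 τ) - M.c)) hk ?_ ?_
      (by fun_prop) (by fun_prop)]
  · rw [intervalIntegral.integral_eq_sub_of_hasDerivAt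
      (f := fun τ => Real.exp (-M.mu * (T - k)) *
        ((M.B - M.c / M.lam) * M.pbar * Real.exp (-M.lam * (k - τ)) - M.c * (1 - M.pbar) * τ))
      (fun τ _ => (((hasDerivAt_exp_sub M.lam k τ).const_mul _).sub
        ((hasDerivAt_id' τ).const_mul _)).const_mul _)
      (Continuous.intervalIntegrable (by fun_prop) _ _), doValue]
    simp
    ring
  · filter_upwards [h.ae_eq_one ha hk] with τ h1 hτ
    have e := M.noSolution_mul_belief hp T a τ
    have hA : pastDoing T a τ = k - τ := by
      rw [h τ ⟨hτ.1.le, hτ.2.trans hk.2⟩, max_eq_right (by linarith [hτ.2])]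
    have e2 : M.noProgress T a τ = Real.exp (-M.mu * (T - k)) := by
      rw [noProgress, hA]; congr 1; ring
    calc _ = M.noProgress T a τ * (M.noSolution T a τ * (M.mu * (1 - a τ) * M.V τ - M.c) +
          M.lam * a τ * (M.noSolution T a τ * M.belief T a τ) * M.B) := by ring
      _ = _ := by
        rw [e, e2, noSolution, hA, h1 hτ]
        field_simp
        ring
  · filter_upwards [h.ae_eq_zero ha hk] with τ h1 hτ
    have hA : pastDoing T a τ = 0 := by
      rw [h τ ⟨hk.1.trans hτ.1.le, hτ.2⟩, max_eq_left (by linarith [hτ.1])]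
    rw [h1 hτ, noProgress, noSolution, hA, max_eq_right (hk.1.trans hτ.1.le)]
    simp

theorem hasDerivAt_switchPayoff (hlam : 0 < M.lam) (hV : ContinuousOn M.V (Ici 0)) (T : ℝ) {k : ℝ}
    (hk : 0 ≤ k) :
    HasDerivAt (M.switchPayoff T) (Real.exp (-M.mu * (T - k)) * M.switchGain k) k := by
  -- `V` is controlled only on `[0, ∞)`; freezing it to the left of zero makes the derivative
  -- two-sided at `k = 0` too.
  have hVc : Continuous fun τ => M.V (max 0 τ) :=
    hV.comp_continuous (by fun_prop) fun τ => le_max_left 0 τ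
  have hf : Continuous fun τ => Real.exp (-M.mu * (T - τ)) * (M.mu * M.V (max 0 τ) - M.c) := by
    fun_prop
  have h1 := intervalIntegral.integral_hasDerivAt_left (hf.intervalIntegrable k T)
    hf.stronglyMeasurable.stronglyMeasurableAtFilter hf.continuousAt
  have h2 : HasDerivAt (fun k => Real.exp (-M.lam * k))
      (Real.exp (-M.lam * k) * (-M.lam * 1)) k := ((hasDerivAt_id' k).const_mul (-M.lam)).exp
  have h3 : HasDerivAt M.doValue _ k :=
    ((h2.const_sub 1).const_mul ((M.B - M.c / M.lam) * M.pbar)).sub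
      ((hasDerivAt_id' k).const_mul (M.c * (1 - M.pbar)))
  have h4 := h1.add ((hasDerivAt_exp_sub M.mu T k).mul h3)
  refine HasDerivAt.congr_deriv h4 ?_
  rw [max_eq_right hk, switchGain, doValue]
  field_simp
  ring

theorem IsPolicy.zero : IsPolicy T fun _ => 0 := ⟨measurable_const, fun _ _ => by simp⟩

theorem IsPolicy.switchesAt_delay (ha : IsPolicy T a) {k : ℝ} (hk : k ∈ Icc 0 T) :
    SwitchesAt T (ThinkDo.delay a k T) k := fun τ hτ => by
  rw [ha.pastDoing_delay_of_le hk.1 hk.2 le_rfl hτ.1 hτ.2, pastDoing_self, zero_add]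

/-! ### The optimal switching time -/

namespace Regular

theorem hasDerivAt_switchGain (h : Regular M Vinf) {k : ℝ} (hk : 0 < k) :
    HasDerivAt M.switchGain
      (M.pbar * (M.mu * M.c - (M.lam - M.mu) * Real.exp (-M.lam * k) * (M.lam * M.B - M.c)) -
        M.mu * (derivWithin M.V (Ici 0) k + M.c)) k := by
  have hl := h.lam_pos
  have h2 : HasDerivAt (fun k => Real.exp (-M.lam * k))
      (Real.exp (-M.lam * k) * (-M.lam * 1)) k := ((hasDerivAt_id' k).const_mul (-M.lam)).exp
  have hc := (hasDerivAt_id' k).const_mul M.c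
  have h3 := ((((hc.const_add M.B).const_mul M.mu).add
    ((((h2.const_sub 1).mul_const (M.B - M.c / M.lam)).const_sub M.B).const_mul
      (M.lam - M.mu))).const_mul M.pbar).sub
    (((hasDerivAt_value h.contDiffOn_one hk).add hc).const_mul M.mu)
  refine HasDerivAt.congr_deriv h3 ?_
  field_simp
  ring

theorem continuousOn_switchGain (h : Regular M Vinf) : ContinuousOn M.switchGain (Ici 0) := by
  have := h.smooth.continuousOn
  unfold switchGain
  fun_prop

theorem one_sub_exp_le (h : Regular M Vinf) (k : ℝ) : (1 - Real.exp (-M.lam * k)) / M.lam ≤ k := by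
  rw [div_le_iff₀ h.lam_pos]
  linarith [Real.add_one_le_exp (-M.lam * k)]

theorem exp_le_one (h : Regular M Vinf) {k : ℝ} (hk : 0 ≤ k) : Real.exp (-M.lam * k) ≤ 1 :=
  Real.exp_le_one_iff.2 (by nlinarith [h.lam_pos])

/-- The left side is minus a sum of `μ` times the belief gain at `pbar`, nonnegative here, and a
positive remainder. It makes `switchGain` times `exp (λ pbar k)` strictly decreasing, hence a single
crossing. -/
theorem switchGain_growth (h : Regular M Vinf) (hle : (M.pbar : EReal) ≤ M.pHat Vinf) {k : ℝ}
    (hk : 0 ≤ k) :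
    M.pbar * (M.mu * M.c - (M.lam - M.mu) * Real.exp (-M.lam * k) * (M.lam * M.B - M.c)) -
        M.mu * (derivWithin M.V (Ici 0) k + M.c) + M.lam * M.pbar * M.switchGain k < 0 := by
  obtain ⟨hp0, hp1⟩ := h.pbar_mem
  have hl := h.lam_pos
  have hm := h.mu_pos
  have hB := h.B_pos
  have hc := h.c_pos
  have hE := Real.exp_pos (-M.lam * k)
  have hE1 := h.exp_le_one hk
  have hs := h.one_sub_exp_le k
  have hg := h.gain_pbar_nonneg hle hk
  set E := Real.exp (-M.lam * k) with hEdef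
  have key : M.pbar * (M.mu * M.c - (M.lam - M.mu) * E * (M.lam * M.B - M.c)) -
        M.mu * (derivWithin M.V (Ici 0) k + M.c) + M.lam * M.pbar * M.switchGain k =
      -(M.mu * M.beliefGain k M.pbar +
        M.lam * M.pbar * (1 - M.pbar) * (M.lam * M.B * E + M.c * (1 - E) +
          M.mu * (M.B * (1 - E) + M.c * (k - (1 - E) / M.lam)))) := by
    rw [switchGain, beliefGain, ← hEdef]
    field_simp
    ring
  rw [key, neg_lt_zero]
  have h1 : 0 < 1 - M.pbar := by linarith
  have h2 : 0 ≤ 1 - E := by linarith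
  have h3 : 0 ≤ k - (1 - E) / M.lam := by linarith
  positivity

/-- `λ - μ` may be negative; regrouping by `exp (-λ k)` and its complement leaves only nonnegative
terms. -/
theorem denominator_pos (h : Regular M Vinf) {k : ℝ} (hk : 0 ≤ k) :
    0 < M.mu * (M.B + M.c * k) +
      (M.lam - M.mu) * (M.B - (1 - Real.exp (-M.lam * k)) * (M.B - M.c / M.lam)) := by
  have hl := h.lam_pos
  have hm := h.mu_pos
  have hB := h.B_pos
  have hc := h.c_pos
  have hE := Real.exp_pos (-M.lam * k)
  have h2 : 0 ≤ 1 - Real.exp (-M.lam * k) := by linarith [h.exp_le_one hk]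
  have h3 : 0 ≤ k - (1 - Real.exp (-M.lam * k)) / M.lam := by linarith [h.one_sub_exp_le k]
  have key : M.mu * (M.B + M.c * k) +
      (M.lam - M.mu) * (M.B - (1 - Real.exp (-M.lam * k)) * (M.B - M.c / M.lam)) =
      M.lam * M.B * Real.exp (-M.lam * k) + M.c * (1 - Real.exp (-M.lam * k)) +
        M.mu * (M.B * (1 - Real.exp (-M.lam * k)) +
          M.c * (k - (1 - Real.exp (-M.lam * k)) / M.lam)) := by
    field_simp
    ring
  rw [key]
  positivity

/-- `switchGain` is `pbar` times the denominator of `qRatio` minus its numerator, and truncation at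
one is harmless since `pbar < 1`. -/
theorem q_eq_iff (h : Regular M Vinf) {k : ℝ} (hk : 0 ≤ k) :
    M.q k = M.pbar ↔ M.switchGain k = 0 := by
  have hK := h.denominator_pos hk
  have h1 : M.q k = M.pbar ↔ M.qRatio k = M.pbar := by
    have := h.pbar_mem.2
    rw [q]
    constructor
    · intro h2
      rcases min_choice 1 (M.qRatio k) with h3 | h3 <;> rw [h3] at h2
      · linarith
      · exact h2
    · intro h2
      rw [h2, min_eq_right this.le]
  rw [h1, qRatio, div_eq_iff hK.ne', switchGain, sub_eq_zero, eq_comm]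

/-- The unique time at which doing for the rest of the game becomes worthwhile. -/
theorem exists_switch_time (h : Regular M Vinf) (hle : (M.pbar : EReal) ≤ M.pHat Vinf) :
    ∃ T₁ : ℝ, 0 < T₁ ∧ M.switchGain T₁ = 0 ∧ (∀ k, 0 ≤ k → k < T₁ → 0 < M.switchGain k) ∧
      ∀ k, T₁ < k → M.switchGain k < 0 := by
  obtain ⟨hp0, hp1⟩ := h.pbar_mem
  have hl := h.lam_pos
  have hm := h.mu_pos
  have hB := h.B_pos
  have hc := h.c_pos
  have hd : ∀ k, HasDerivAt (fun k => Real.exp (M.lam * M.pbar * k))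
      (Real.exp (M.lam * M.pbar * k) * (M.lam * M.pbar * 1)) k :=
    fun k => ((hasDerivAt_id' k).const_mul (M.lam * M.pbar)).exp
  have hanti : StrictAntiOn (fun k => Real.exp (M.lam * M.pbar * k) * M.switchGain k) (Ici 0) := by
    refine strictAntiOn_of_deriv_neg (convex_Ici 0)
      (ContinuousOn.mul (by fun_prop) h.continuousOn_switchGain) fun k hk => ?_
    rw [interior_Ici] at hk
    have hder := ((hd k).mul (h.hasDerivAt_switchGain hk)).deriv
    have hneg := mul_neg_of_pos_of_neg (Real.exp_pos (M.lam * M.pbar * k))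
      (h.switchGain_growth hle (le_of_lt hk))
    calc _ = _ := hder
      _ = _ := by ring
      _ < 0 := hneg
  have h0 : 0 < M.switchGain 0 := by
    have : M.switchGain 0 = M.pbar * (M.lam * M.B) := by
      simp only [switchGain, h.value_zero, mul_zero, add_zero, Real.exp_zero]
      ring
    rw [this]; positivity
  have hq : 0 < 1 - M.pbar := by linarith
  -- `R` makes the linear loss `μ c (1 - pbar) R` exceed the constant gains by `μ c (1 - pbar)`.
  set R := M.pbar * (M.mu * M.B + M.lam * M.B + M.c) / (M.mu * M.c * (1 - M.pbar)) + 1 with hR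
  have hRpos : 0 < R := by positivity
  have hRneg : M.switchGain R < 0 := by
    have hE := Real.exp_pos (-M.lam * R)
    have hE1 := h.exp_le_one hRpos.le
    have hVR : 0 < M.V R := by
      have := h.strictMonoOn_value (mem_Ici.2 le_rfl) (mem_Ici.2 hRpos.le) hRpos
      rwa [h.value_zero] at this
    have e1 : M.mu * M.c * (1 - M.pbar) * R =
        M.pbar * (M.mu * M.B + M.lam * M.B + M.c) + M.mu * M.c * (1 - M.pbar) := by
      rw [hR]; field_simp
    have e2 : M.switchGain R = M.pbar * (M.mu * M.B + M.lam * M.B + M.c)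
        - M.mu * M.c * (1 - M.pbar) * R - M.mu * M.V R
        - M.pbar * (M.mu * M.B * Real.exp (-M.lam * R) +
          M.lam * M.B * (1 - Real.exp (-M.lam * R)) + M.c * Real.exp (-M.lam * R)
          + M.mu * M.c * (1 - Real.exp (-M.lam * R)) / M.lam) := by
      rw [switchGain]
      field_simp
      ring
    have h2 : 0 ≤ 1 - Real.exp (-M.lam * R) := by linarith
    have h3 : 0 < M.mu * M.V R := by positivity
    have h4 : 0 < M.mu * M.c * (1 - M.pbar) := by positivity
    have h5 : 0 ≤ M.pbar * (M.mu * M.B * Real.exp (-M.lam * R) +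
          M.lam * M.B * (1 - Real.exp (-M.lam * R)) + M.c * Real.exp (-M.lam * R)
          + M.mu * M.c * (1 - Real.exp (-M.lam * R)) / M.lam) := by positivity
    linarith
  obtain ⟨T₁, hT, hz⟩ : ∃ t ∈ Icc 0 R, M.switchGain t = 0 :=
    intermediate_value_Icc' hRpos.le (h.continuousOn_switchGain.mono fun x hx => hx.1)
      ⟨hRneg.le, h0.le⟩
  have hT1 : 0 < T₁ := lt_of_le_of_ne hT.1 fun e => by rw [← e] at hz; linarith
  refine ⟨T₁, hT1, hz, fun k hk hlt => ?_, fun k hlt => ?_⟩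
  · have := hanti hk hT.1 hlt
    simp only [hz, mul_zero] at this
    exact pos_of_mul_pos_right this (Real.exp_pos _).le
  · have := hanti hT.1 (hT.1.trans hlt.le) hlt
    simp only [hz, mul_zero] at this
    exact (pos_iff_neg_of_mul_neg this).1 (Real.exp_pos _)

/-- The payoff rises in `k` up to `T₁` and falls after it, so the peak over `[0, T]` is `T₁` clipped
at `T`. -/
theorem switchPayoff_lt (h : Regular M Vinf) {T₁ : ℝ} (hT₁ : 0 < T₁)
    (hpos : ∀ k, 0 ≤ k → k < T₁ → 0 < M.switchGain k)
    (hneg : ∀ k, T₁ < k → M.switchGain k < 0) {k : ℝ} (hk : k ∈ Icc 0 T) (hne : k ≠ min T T₁) :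
    M.switchPayoff T k < M.switchPayoff T (min T T₁) := by
  have hT : 0 ≤ T := hk.1.trans hk.2
  have hs0 : 0 ≤ min T T₁ := le_min hT hT₁.le
  have hd := fun {k : ℝ} (hk : 0 ≤ k) =>
    hasDerivAt_switchPayoff h.lam_pos h.smooth.continuousOn T hk
  rcases lt_or_gt_of_ne hne with hlt | hlt
  · refine strictMonoOn_of_deriv_pos (convex_Icc 0 (min T T₁))
      (fun x hx => (hd hx.1).continuousAt.continuousWithinAt) (fun x hx => ?_)
      ⟨hk.1, hlt.le⟩ ⟨hs0, le_rfl⟩ hlt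
    rw [interior_Icc] at hx
    rw [(hd hx.1.le).deriv]
    exact mul_pos (Real.exp_pos _) (hpos x hx.1.le (hx.2.trans_le (min_le_right _ _)))
  · refine strictAntiOn_of_deriv_neg (convex_Icc (min T T₁) T)
      (fun x hx => (hd (hs0.trans hx.1)).continuousAt.continuousWithinAt) (fun x hx => ?_)
      ⟨le_rfl, min_le_left _ _⟩ ⟨hlt.le, hk.2⟩ hlt
    rw [interior_Icc] at hx
    rw [(hd (hs0.trans hx.1.le)).deriv]
    refine mul_neg_of_pos_of_neg (Real.exp_pos _) (hneg x ?_)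
    rcases min_lt_iff.1 hx.1 with h1 | h1
    · exact absurd hx.2 (not_lt.2 h1.le)
    · exact h1

/-- Delaying from the very start (`s = T`) is profitable, as the swap gain is positive after any
positive doing effort. -/
theorem payoff_le_switchPayoff (h : Regular M Vinf) (hle : (M.pbar : EReal) ≤ M.pHat Vinf)
    (hT : 0 ≤ T) (ha : IsPolicy T a) :
    pastDoing T a 0 ∈ Icc 0 T ∧ M.payoff T a ≤ M.switchPayoff T (pastDoing T a 0) ∧
    (M.switchPayoff T (pastDoing T a 0) ≤ M.payoff T a → SwitchesAt T a (pastDoing T a 0)) := by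
  have hk := ha.pastDoing_mem (x := 0) ⟨le_rfl, hT⟩
  have hd := ha.payoff_delay h.pbar_mem h.mu_pos h.contDiffOn_one (s := T) ⟨hT, le_rfl⟩
    fun τ hτ y hy => h.swapGain_pos_of_le hle hτ.1 (by rwa [pastDoing_self] at hy)
  simp only [pastDoing_self, sub_zero, zero_add] at hd
  rw [(ha.switchesAt_delay hk).payoff_eq (ha.delay _ _) hk h.pbar_mem h.lam_pos
    h.smooth.continuousOn] at hd
  exact ⟨hk, hd⟩

end Regular

end ThinkDo

end

theorem corollary1 (M : ThinkDo) (Vinf : ℝ)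
    (hpbar : M.pbar ∈ Ioo (0 : ℝ) 1) (hlam : 0 < M.lam) (hmu : 0 < M.mu)
    (hB : 0 < M.B) (hc : 0 < M.c)
    (hVsmooth : ContDiffOn ℝ 3 M.V (Ici 0))
    (hVzero : M.V 0 = 0)
    (hVincr : ∀ τ ∈ Ici (0 : ℝ), 0 < derivWithin M.V (Ici 0) τ)
    (hVconc : ∀ τ ∈ Ici (0 : ℝ),
      M.pbar * M.lam ≤ -iteratedDerivWithin 2 M.V (Ici 0) τ / derivWithin M.V (Ici 0) τ)
    (hVlim : Tendsto M.V atTop (𝓝 Vinf))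
    (hVinf_low : M.c / M.mu < Vinf)
    (hVinf_high : Vinf ≤ M.B + M.c / M.mu) :
    (∀ T : ℝ, 0 ≤ T → ∀ a : ℝ → ℝ, M.IsOptimal T a →
      ∀ᵐ τ ∂(volume.restrict (Icc 0 T)), a τ < 1 →
        min (M.pHat Vinf) (M.pbar : EReal) ≤ (M.belief T a τ : EReal) ∧
        (M.pHat Vinf < (M.pbar : EReal) → M.pHat Vinf < (M.belief T a τ : EReal))) ∧
    ((M.pbar : EReal) ≤ M.pHat Vinf →
      ∃ T₁ : ℝ, 0 < T₁ ∧ (∀ τ : ℝ, 0 ≤ τ → (M.q τ = M.pbar ↔ τ = T₁)) ∧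
        ∃ P : ℝ → ℝ,
          (∀ T : ℝ, 0 ≤ T → (∃ a : ℝ → ℝ, M.IsOptimal T a) ∧
            ∀ a : ℝ → ℝ, M.IsOptimal T a → M.doingProb T a = P T) ∧
          IsMaxOn P (Ici 0) T₁) := by
  have h : ThinkDo.Regular M Vinf :=
    ⟨hpbar, hlam, hmu, hB, hc, hVsmooth, hVzero, hVincr, hVconc, hVlim, hVinf_high⟩
  refine ⟨fun T hT a ha => h.thinking_belief hT ha, fun hle => ?_⟩
  obtain ⟨T₁, hT₁, hz, hpos, hneg⟩ := h.exists_switch_time hle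
  -- `P T` is the chance of no progress while thinking for `T - min T T₁`, times that of success in
  -- doing for `min T T₁`.
  refine ⟨T₁, hT₁, fun τ hτ => ?_, fun T => Real.exp (-M.mu * (T - min T T₁)) *
    (M.pbar * (1 - Real.exp (-M.lam * min T T₁))), fun T hT => ?_, fun T hT => ?_⟩
  · rw [h.q_eq_iff hτ]
    refine ⟨fun h0 => ?_, fun h0 => h0 ▸ hz⟩
    rcases lt_trichotomy τ T₁ with h1 | h1 | h1
    · linarith [hpos τ hτ h1]
    · exact h1
    · linarith [hneg τ h1]
  · have hs : min T T₁ ∈ Icc 0 T := ⟨le_min hT hT₁.le, min_le_left _ _⟩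
    have hpol : ThinkDo.IsPolicy T (ThinkDo.delay (fun _ => 0) (min T T₁) T) :=
      ThinkDo.IsPolicy.zero.delay _ _
    have hval := (ThinkDo.IsPolicy.zero.switchesAt_delay hs).payoff_eq hpol hs hpbar hlam
      hVsmooth.continuousOn
    refine ⟨⟨_, hpol, fun b hb => ?_⟩, fun a ha => ?_⟩
    · obtain ⟨hk, h1, -⟩ := h.payoff_le_switchPayoff hle hT hb
      rw [hval]
      refine h1.trans ?_
      by_cases hne : ThinkDo.pastDoing T b 0 = min T T₁
      · rw [hne]
      · exact (h.switchPayoff_lt hT₁ hpos hneg hk hne).le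
    · obtain ⟨hk, h1, h2⟩ := h.payoff_le_switchPayoff hle hT ha.1
      have h3 := ha.2 _ hpol
      rw [hval] at h3
      -- The strict peak pins down total effort; equality of payoffs then forces the switching path
      -- itself.
      have heq : ThinkDo.pastDoing T a 0 = min T T₁ := by
        by_contra hne
        linarith [h.switchPayoff_lt hT₁ hpos hneg hk hne]
      rw [heq] at h2
      exact (h2 h3).doingProb_eq ha.1 hs hpbar
  · have hT0 : 0 ≤ T := hT
    have hs0 : 0 ≤ min T T₁ := le_min hT0 hT₁.le
    have h1 : Real.exp (-M.mu * (T - min T T₁)) ≤ 1 :=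
      Real.exp_le_one_iff.2 (by nlinarith [min_le_left T T₁])
    have h2 : Real.exp (-M.lam * T₁) ≤ Real.exp (-M.lam * min T T₁) :=
      Real.exp_le_exp.2 (by nlinarith [min_le_right T T₁])
    have h3 : Real.exp (-M.lam * min T T₁) ≤ 1 := h.exp_le_one hs0
    have hp := hpbar.1
    simp only [mem_ofPred_eq, min_self, sub_self, mul_zero, Real.exp_zero, one_mul]
    calc _ ≤ 1 * (M.pbar * (1 - Real.exp (-M.lam * min T T₁))) :=
          mul_le_mul_of_nonneg_right h1 (mul_nonneg hp.le (by linarith))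
      _ ≤ _ := by
        rw [one_mul]
        exact mul_le_mul_of_nonneg_left (by linarith) hp.le
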